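/- Let $n\ge 2$. For a word $u$ on $\{a,b\}$ put $\delta(u)=|u|_a-|u|_b$, and let $D_n$ be the set of words $w$ with $n-1$ letters $a$ and $n$ letters $b$ such that $\delta(u)\ge 0$ for every strict prefix $u$ of $w$. For $w\in D_n$ write $w=uv$, where $u$ is the longest prefix of $w$ at which $\delta$ attains its maximum over all prefixes of $w$, and let $\Phi(w)=\tilde u\tilde v$, where $\tilde{\ }$ denotes the reversal of a word. Draw $w$ as a lattice path from the origin, with a north step $(0,1)$ for each $a$ and an east step $(1,0)$ for each $b$. Consider the strip consisting of the unit cells with lower left corner $(i,j)$, $i\in\mathbb Z$, $0\le j<n-1$, and give this cell the label $nj-(n-1)(i+1)$. (So the cell $(-1,0)$ has label $0$, and labels increase by $1$ for a north-east move and by $n-1$ for a west move inside the strip.) In each row, the cells to the left (right) of the north step of the path in that row form the left (right) region. Let $\mathrm{lastright}(w)$ be the highest label of a cell of the right region. For $s\in\mathbb Z$, let $\mathrm{left}(w,s)$ be the number of cells of the left region with label $\le s$, and let $\mathrm{right}(w,s)$ be the number of cells of the right region with label $>s$. This highest label exists, and these numbers are finite. Then the map $(w,s)\mapsto(w',s')=(\Phi(w),\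 \mathrm{lastright}(w)-s-1)$ is an involution of $D_n\times\mathbb Z$, and for all $(w,s)\in D_n\times\mathbb Z$ $$\mathrm{left}(w,s)=\mathrm{right}(w',s')\quad\text{and}\quad \mathrm{left}(w',s')=\mathrm{right}(w,s).$$ As a consequence, the series $$L_n(x,y)=\sum_{w\in D_n}\ \sum_{s=-\infty}^{+\infty}x^{\mathrm{left}(w,s)}\,y^{\mathrm{right}(w,s)}$$ is a well-defined formal power series (each monomial arises from only finitely many pairs $(w,s)$), and it satisfies $L_n(x,y)=L_n(y,x)$. -/

import Mathlib

/-!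
Words on the alphabet `{a, b}` are lists of `DyckStep`, with `a = DyckStep.U` (a north step
`(0,1)` when the word is drawn as a lattice path from the origin) and `b = DyckStep.D`
(an east step `(1,0)`).
-/

namespace DyckStrip

/-- `δ(u) = |u|_a - |u|_b`. -/
def delta (u : List DyckStep) : ℤ := (u.count DyckStep.U : ℤ) - (u.count DyckStep.D : ℤ)

/-- `D_n`: words with `n - 1` letters `a` and `n` letters `b`, all of whose strict prefixes `u`
satisfy `δ(u) ≥ 0`. -/
def Dset (n : ℕ) : Set (List DyckStep) :=
  {w | w.count DyckStep.U + 1 = n ∧ w.count DyckStep.D = n ∧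
    ∀ u : List DyckStep, u <+: w → u ≠ w → 0 ≤ delta u}

/-- The length of the longest prefix of `w` at which `δ` is maximal among all prefixes of `w`. -/
def cut (w : List DyckStep) : ℕ :=
  Nat.findGreatest (fun k => ∀ j ≤ w.length, delta (w.take j) ≤ delta (w.take k)) w.length

/-- `Φ(uv) = ũ ṽ`, where `u` is the longest prefix with maximal `δ` and `~` reverses a word. -/
def Phi (w : List DyckStep) : List DyckStep :=
  (w.take (cut w)).reverse ++ (w.drop (cut w)).reverse

/-- The path of `w` contains the unit north step from `(x, y)` to `(x, y + 1)`. -/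
def IsNorthStep (w : List DyckStep) (x y : ℕ) : Prop :=
  ∃ u : List DyckStep, u ++ [DyckStep.U] <+: w ∧
    u.count DyckStep.D = x ∧ u.count DyckStep.U = y

/-- A cell `(i, j)` is the unit square with bottom left corner `(i, j)`. In the strip of `n - 1`
rows `0 ≤ j < n - 1`, the cell at the north-west of the origin, `(-1, 0)`, has label `0`; labels
increase by `1` for a move one cell to the north-east inside the strip, and by `n - 1` for a move
one cell to the west. -/
def label (n : ℕ) (c : ℤ × ℕ) : ℤ := (n : ℤ) * c.2 - ((n : ℤ) - 1) * (c.1 + 1)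

/-- The cells of the strip on the left of the path of `w`. -/
def leftRegion (w : List DyckStep) : Set (ℤ × ℕ) :=
  {c | ∃ x : ℕ, IsNorthStep w x c.2 ∧ c.1 < (x : ℤ)}

/-- The cells of the strip on the right of the path of `w`. -/
def rightRegion (w : List DyckStep) : Set (ℤ × ℕ) :=
  {c | ∃ x : ℕ, IsNorthStep w x c.2 ∧ (x : ℤ) ≤ c.1}

/-- The highest label of a cell in the right region. -/
noncomputable def lastright (n : ℕ) (w : List DyckStep) : ℤ :=
  sSup (label n '' rightRegion w)

/-- Cells of the left region with label not greater than `s`. -/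
def leftCells (n : ℕ) (w : List DyckStep) (s : ℤ) : Set (ℤ × ℕ) :=
  {c | c ∈ leftRegion w ∧ label n c ≤ s}

/-- Cells of the right region with label strictly greater than `s`. -/
def rightCells (n : ℕ) (w : List DyckStep) (s : ℤ) : Set (ℤ × ℕ) :=
  {c | c ∈ rightRegion w ∧ s < label n c}

/-- `left(w, s)`. -/
noncomputable def leftNum (n : ℕ) (w : List DyckStep) (s : ℤ) : ℕ := (leftCells n w s).ncard

/-- `right(w, s)`. -/
noncomputable def rightNum (n : ℕ) (w : List DyckStep) (s : ℤ) : ℕ := (rightCells n w s).ncard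

/-- `(w, s) ↦ (Φ(w), lastright(w) - s - 1)`. -/
noncomputable def swapMap (n : ℕ) (p : List DyckStep × ℤ) : List DyckStep × ℤ :=
  (Phi p.1, lastright n p.1 - p.2 - 1)

/-- The monomial `x ^ left(w, s) * y ^ right(w, s)`, where `x` and `y` are the variables with
index `0` and `1`. -/
noncomputable def term (n : ℕ) (w : List DyckStep) (s : ℤ) : MvPowerSeries (Fin 2) ℤ :=
  MvPowerSeries.X 0 ^ leftNum n w s * MvPowerSeries.X 1 ^ rightNum n w s

open scoped MvPowerSeries.WithPiTopology in
/-- The formal power series `L_n(x, y)`; the sum is taken coefficientwise (product topology on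
coefficients, `ℤ` discrete). -/
noncomputable def L (n : ℕ) : MvPowerSeries (Fin 2) ℤ :=
  ∑' w : Dset n, ∑' s : ℤ, term n (w : List DyckStep) s

end DyckStrip

open scoped MvPowerSeries.WithPiTopology

namespace DyckStrip

open DyckStep

/-! The label of the cell just left of a north step is the value m of `level n` at the start of that
step. So the left labels are the numbers m + (n-1)k and the right labels the numbers m - (n-1)(k+1),
with k ≥ 0. Write w = uv at the peak. Since w has level 0, reversing u and v in place acts on all
north levels by the single reflection m ↦ level u - n - m (`mem_northLevels_Phi`). Every word of D_n
has least north level 0, so the greatest is level u - n, which determines `lastright`. Then t ↦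
lastright - t carries the left labels of w to the right labels of Φ(w)
(`mem_label_image_rightRegion_Phi`), and counting labels counts cells because `label` is injective
on the strip. For the series, D_n is finite and fixed exponents bound s on both sides. -/

/-! ### Factorization at the last peak, and Φ as an involution of D_n. -/

@[simp] theorem delta_nil : delta [] = 0 := by simp [delta]

@[simp] theorem delta_append (u v : List DyckStep) : delta (u ++ v) = delta u + delta v := by
  simp only [delta, List.count_append]; push_cast; ring

@[simp] theorem delta_reverse (u : List DyckStep) : delta u.reverse = delta u := by
  simp [delta]

/-- `u` is the longest prefix of `u ++ v` at which `δ` is maximal. -/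
def IsPeakSplit (u v : List DyckStep) : Prop :=
  (∀ p t, u = p ++ t → delta p ≤ delta u) ∧ ∀ q t, v = q ++ t → q ≠ [] → delta q < 0

theorem isPeakSplit_cut (w : List DyckStep) : IsPeakSplit (w.take (cut w)) (w.drop (cut w)) := by
  obtain ⟨k, hk, hmax⟩ := Finset.exists_max_image (Finset.range (w.length + 1))
    (fun k => delta (w.take k)) ⟨0, by simp⟩
  have hk' : k ≤ w.length := by simpa [Nat.lt_succ_iff] using hk
  have hspec : ∀ j ≤ w.length, delta (w.take j) ≤ delta (w.take (cut w)) :=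
    Nat.findGreatest_spec (P := fun k => ∀ j ≤ w.length, delta (w.take j) ≤ delta (w.take k))
      hk' fun j hj => hmax j (by simpa [Nat.lt_succ_iff] using hj)
  have hcut : cut w ≤ w.length := Nat.findGreatest_le _
  refine ⟨fun p t h => ?_, fun q t h hq => ?_⟩
  · have hw : w = p ++ (t ++ w.drop (cut w)) := by
      rw [← List.append_assoc, ← h, List.take_append_drop]
    have hp : p = w.take p.length := by
      conv_rhs => rw [hw]
      simp
    rw [hp]
    exact hspec _ (by rw [hw]; simp)
  · by_contra! hlt
    have hw : w = (w.take (cut w) ++ q) ++ t := by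
      rw [List.append_assoc, ← h, List.take_append_drop]
    have hlen : (w.take (cut w) ++ q).length = cut w + q.length := by simp [hcut]
    have htake : w.take (cut w + q.length) = w.take (cut w) ++ q := by
      have := List.take_left (l₁ := w.take (cut w) ++ q) (l₂ := t)
      rwa [← hw, hlen] at this
    -- Otherwise the longer prefix uq would also attain the maximum.
    have hle : cut w + q.length ≤ cut w := by
      refine Nat.le_findGreatest ?_ fun j hj => ?_
      · have := congrArg List.length hw
        rw [List.length_append, hlen] at this
        omega
      · rw [htake, delta_append]
        linarith [hspec j hj]
    have := List.length_pos_iff.2 hq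
    omega

theorem cut_append {u v : List DyckStep} (h : IsPeakSplit u v) : cut (u ++ v) = u.length := by
  refine Nat.findGreatest_eq_iff.2 ⟨by simp, fun _ j _ => ?_, fun k hk hkl hmax => ?_⟩
  · rw [List.take_append, List.take_left, delta_append]
    have h1 := h.1 (u.take j) (u.drop j) (List.take_append_drop _ _).symm
    have h2 : delta (v.take (j - u.length)) ≤ 0 := by
      by_cases hv : v.take (j - u.length) = []
      · simp [hv]
      · exact (h.2 _ (v.drop (j - u.length)) (List.take_append_drop _ _).symm hv).le
    linarith
  · have h1 := hmax u.length (by simp)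
    rw [List.take_left, List.take_append, List.take_of_length_le hk.le, delta_append] at h1
    have h2 := h.2 (v.take (k - u.length)) (v.drop (k - u.length))
      (List.take_append_drop _ _).symm (by
        intro h0
        have := congrArg List.length h0
        simp only [List.length_append, List.length_take, List.length_nil] at this hkl
        omega)
    linarith

theorem Phi_append {u v : List DyckStep} (h : IsPeakSplit u v) :
    Phi (u ++ v) = u.reverse ++ v.reverse := by
  simp [Phi, cut_append h]

theorem exists_isPeakSplit (w : List DyckStep) : ∃ u v, w = u ++ v ∧ IsPeakSplit u v :=
  ⟨_, _, (List.take_append_drop _ _).symm, isPeakSplit_cut w⟩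

theorem delta_of_mem {n : ℕ} {w : List DyckStep} (hw : w ∈ Dset n) : delta w = -1 := by
  obtain ⟨h1, h2, -⟩ := hw
  simp only [delta]; omega

theorem delta_nonneg_of_mem {n : ℕ} {p t : List DyckStep} (hw : p ++ t ∈ Dset n) (ht : t ≠ []) :
    0 ≤ delta p :=
  hw.2.2 p (List.prefix_append p t) (by simpa using ht)

theorem IsPeakSplit.right_ne_nil {n : ℕ} {u v : List DyckStep} (h : IsPeakSplit u v)
    (hw : u ++ v ∈ Dset n) : v ≠ [] := by
  rintro rfl
  have h1 := delta_of_mem hw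
  have h2 := h.1 [] u rfl
  simp only [List.append_nil, delta_nil] at h1 h2
  omega

/-- A prefix of a reversed factor is complementary to a strict prefix of w, whose δ is nonnegative;
comparing with δ(u), or with δ(w) = -1, gives the two peak conditions. -/
theorem IsPeakSplit.reverse {n : ℕ} {u v : List DyckStep} (h : IsPeakSplit u v)
    (hw : u ++ v ∈ Dset n) : IsPeakSplit u.reverse v.reverse := by
  have hv := h.right_ne_nil hw
  have hd := delta_of_mem hw
  rw [delta_append] at hd
  refine ⟨fun p t hpt => ?_, fun q t hqt hq => ?_⟩
  · have hu : u = t.reverse ++ p.reverse := by rw [← List.reverse_append, ← hpt]; simp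
    have h0 : 0 ≤ delta t.reverse :=
      delta_nonneg_of_mem (n := n) (t := p.reverse ++ v) (by rwa [← List.append_assoc, ← hu])
        (by simp [hv])
    have hdu := congrArg delta hu
    simp only [delta_append, delta_reverse] at hdu h0 ⊢
    omega
  · have hv' : v = t.reverse ++ q.reverse := by rw [← List.reverse_append, ← hqt]; simp
    have h0 : 0 ≤ delta (u ++ t.reverse) :=
      delta_nonneg_of_mem (n := n) (t := q.reverse) (by rwa [List.append_assoc, ← hv'])
        (by simpa using hq)
    have hdv := congrArg delta hv'
    simp only [delta_append, delta_reverse] at hdv h0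
    omega

/-- Dual to `IsPeakSplit.reverse`: the peak conditions on u and v become nonnegativity before and
after the end of ũ. -/
theorem Phi_mem {n : ℕ} {w : List DyckStep} (hw : w ∈ Dset n) : Phi w ∈ Dset n := by
  obtain ⟨u, v, rfl, h⟩ := exists_isPeakSplit w
  have hv := h.right_ne_nil hw
  have hd := delta_of_mem hw
  rw [delta_append] at hd
  rw [Phi_append h]
  refine ⟨by simpa using hw.1, by simpa using hw.2.1, fun p hp hne => ?_⟩
  obtain ⟨r, hr⟩ := hp
  have hr0 : r ≠ [] := by rintro rfl; simp at hr; exact hne hr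
  rcases List.append_eq_append_iff.1 hr with ⟨x, hx, -⟩ | ⟨x, hx, hx'⟩
  · have hu := h.1 x.reverse p.reverse (by rw [← List.reverse_append, ← hx]; simp)
    have hdu := congrArg delta hx
    simp only [delta_append, delta_reverse] at hdu hu
    omega
  · have hq := h.2 r.reverse x.reverse (by rw [← List.reverse_append, ← hx']; simp)
      (by simpa using hr0)
    have hdv := congrArg delta hx'
    have hdp := congrArg delta hx
    simp only [delta_append, delta_reverse] at hdv hdp hq
    omega

theorem Phi_Phi {n : ℕ} {w : List DyckStep} (hw : w ∈ Dset n) : Phi (Phi w) = w := by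
  obtain ⟨u, v, rfl, h⟩ := exists_isPeakSplit w
  rw [Phi_append h, Phi_append (h.reverse hw), List.reverse_reverse, List.reverse_reverse]

theorem finite_Dset (n : ℕ) : (Dset n).Finite := by
  have : Finite DyckStep :=
    Finite.of_injective (fun s : DyckStep => decide (s = U)) (by
      rintro (_ | _) (_ | _) <;> simp)
  refine (List.finite_length_le DyckStep (2 * n)).subset fun w hw => ?_
  have hlen : w.length = w.count U + w.count D := by
    clear hw
    induction w with
    | nil => simp
    | cons s w ih => cases s <;> simp [ih] <;> omega
  obtain ⟨h1, h2, -⟩ := hw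
  simp only [Set.mem_ofPred_eq]
  omega

/-! ### Levels of north steps and their reflection under Φ. -/

/-- The linear form `n |u|_a - (n - 1) |u|_b`. -/
def level (n : ℕ) (u : List DyckStep) : ℤ := n * (u.count U : ℤ) - (n - 1) * (u.count D : ℤ)

@[simp] theorem level_nil (n : ℕ) : level n [] = 0 := by simp [level]

@[simp] theorem level_append (n : ℕ) (u v : List DyckStep) :
    level n (u ++ v) = level n u + level n v := by
  simp only [level, List.count_append]; push_cast; ring

@[simp] theorem level_reverse (n : ℕ) (u : List DyckStep) : level n u.reverse = level n u := by
  simp [level]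

theorem level_cons_U (n : ℕ) (u : List DyckStep) : level n (U :: u) = n + level n u := by
  simp only [level, List.count_cons]; simp; ring

theorem level_of_mem {n : ℕ} {w : List DyckStep} (hw : w ∈ Dset n) : level n w = 0 := by
  obtain ⟨h1, h2, -⟩ := hw
  have h1' : (w.count U : ℤ) = n - 1 := by omega
  rw [level, h1', h2]; ring

/-- The values of `level n` at the starting points of the north steps of `w`. -/
def northLevels (n : ℕ) (w : List DyckStep) : Set ℤ :=
  {m | ∃ p r, w = p ++ U :: r ∧ level n p = m}

theorem mem_northLevels_append {n : ℕ} {u v : List DyckStep} {m : ℤ} :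
    m ∈ northLevels n (u ++ v) ↔ m ∈ northLevels n u ∨ m - level n u ∈ northLevels n v := by
  constructor
  · rintro ⟨p, r, h, rfl⟩
    rcases List.append_eq_append_iff.1 h with ⟨x, rfl, hx⟩ | ⟨x, rfl, hx⟩
    · exact Or.inr ⟨x, r, hx, by simp⟩
    · cases x with
      | nil => exact Or.inr ⟨[], r, by simpa using hx.symm, by simp⟩
      | cons s x =>
        simp only [List.cons_append, List.cons.injEq] at hx
        exact Or.inl ⟨p, x, by rw [hx.1], rfl⟩
  · rintro (⟨p, r, rfl, rfl⟩ | ⟨p, r, rfl, h⟩)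
    · exact ⟨p, r ++ v, by simp, rfl⟩
    · exact ⟨u ++ p, r, by simp, by rw [level_append]; omega⟩

/-- A north step of u from level m to m + n, read backwards, starts at level u - (m + n). -/
theorem mem_northLevels_reverse {n : ℕ} {u : List DyckStep} {m : ℤ} :
    m ∈ northLevels n u.reverse ↔ level n u - n - m ∈ northLevels n u := by
  have key : ∀ (u : List DyckStep) (m : ℤ), m ∈ northLevels n u.reverse →
      level n u - n - m ∈ northLevels n u := by
    rintro u m ⟨p, r, h, rfl⟩
    have hu : u = r.reverse ++ U :: p.reverse := by
      rw [← List.reverse_reverse u, h]; simp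
    refine ⟨r.reverse, p.reverse, hu, ?_⟩
    have := congrArg (level n) hu
    rw [level_append, level_cons_U, level_reverse, level_reverse] at this
    rw [level_reverse]
    omega
  refine ⟨key u m, fun h => ?_⟩
  have := key u.reverse (level n u - n - m) (by simpa using h)
  simpa using this

theorem mem_northLevels_Phi {n : ℕ} {u v : List DyckStep} (h : IsPeakSplit u v)
    (hw : u ++ v ∈ Dset n) {m : ℤ} :
    m ∈ northLevels n (Phi (u ++ v)) ↔ level n u - n - m ∈ northLevels n (u ++ v) := by
  have h0 := level_of_mem hw
  rw [level_append] at h0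
  rw [Phi_append h, mem_northLevels_append, mem_northLevels_append, mem_northLevels_reverse,
    mem_northLevels_reverse, level_reverse,
    show level n v - n - (m - level n u) = level n u - n - m - level n u by omega]

theorem zero_mem_northLevels {n : ℕ} (hn : 2 ≤ n) {w : List DyckStep} (hw : w ∈ Dset n) :
    (0 : ℤ) ∈ northLevels n w := by
  match w, hw with
  | [], hw => have := hw.1; simp at this; omega
  | U :: r, _ => exact ⟨[], r, rfl, by simp⟩
  | D :: r, hw =>
    exfalso
    have hr : r ≠ [] := by rintro rfl; have := hw.1; simp at this; omega
    have := delta_nonneg_of_mem (p := [D]) (t := r) hw hr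
    simp [delta] at this

theorem northLevels_nonneg {n : ℕ} (hn : 2 ≤ n) {w : List DyckStep} (hw : w ∈ Dset n)
    {m : ℤ} (hm : m ∈ northLevels n w) : 0 ≤ m := by
  obtain ⟨p, r, rfl, rfl⟩ := hm
  have h := delta_nonneg_of_mem hw (by simp)
  -- Both terms on the right are nonnegative.
  have : level n p = (n - 1) * delta p + p.count U := by simp only [level, delta]; ring
  rw [this]
  have : (0 : ℤ) ≤ n - 1 := by omega
  positivity

/-! ### Labels of the two regions. -/

theorem mem_label_image_leftRegion {n : ℕ} {w : List DyckStep} {t : ℤ} :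
    t ∈ label n '' leftRegion w ↔ ∃ m ∈ northLevels n w, ∃ k : ℕ, t = m + (n - 1) * k := by
  constructor
  · rintro ⟨⟨i, j⟩, ⟨x, ⟨p, ⟨r, rfl⟩, rfl, rfl⟩, hi⟩, rfl⟩
    refine ⟨level n p, ⟨p, r, by simp, rfl⟩, ((p.count D : ℤ) - 1 - i).toNat, ?_⟩
    rw [Int.toNat_of_nonneg (by simp only at hi; omega)]
    simp only [label, level]; ring
  · rintro ⟨_, ⟨p, r, rfl, rfl⟩, k, rfl⟩
    refine ⟨((p.count D : ℤ) - 1 - k, p.count U), ⟨_, ⟨p, ⟨r, by simp⟩, rfl, rfl⟩, ?_⟩, ?_⟩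
    · simp only; omega
    · simp only [label, level]; ring

theorem mem_label_image_rightRegion {n : ℕ} {w : List DyckStep} {t : ℤ} :
    t ∈ label n '' rightRegion w ↔
      ∃ m ∈ northLevels n w, ∃ k : ℕ, t = m - (n - 1) * (k + 1) := by
  constructor
  · rintro ⟨⟨i, j⟩, ⟨x, ⟨p, ⟨r, rfl⟩, rfl, rfl⟩, hi⟩, rfl⟩
    refine ⟨level n p, ⟨p, r, by simp, rfl⟩, (i - (p.count D : ℤ)).toNat, ?_⟩
    rw [Int.toNat_of_nonneg (by simp only at hi; omega)]
    simp only [label, level]; ring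
  · rintro ⟨_, ⟨p, r, rfl, rfl⟩, k, rfl⟩
    refine ⟨((p.count D : ℤ) + k, p.count U), ⟨_, ⟨p, ⟨r, by simp⟩, rfl, rfl⟩, ?_⟩, ?_⟩
    · simp only; omega
    · simp only [label, level]; ring

theorem IsNorthStep.lt {n : ℕ} {w : List DyckStep} (hw : w ∈ Dset n) {x y : ℕ}
    (h : IsNorthStep w x y) : y < n - 1 := by
  obtain ⟨p, ⟨r, rfl⟩, rfl, rfl⟩ := h
  have := hw.1
  simp at this
  omega

/-- Modulo n - 1 the label is j, so it determines the row among n - 1 rows, and then the column. -/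
theorem label_injOn (n : ℕ) : Set.InjOn (label n) {c | c.2 < n - 1} := by
  rintro ⟨i, j⟩ hj ⟨i', j'⟩ hj' h
  simp only [Set.mem_ofPred_eq, label] at hj hj' h
  have hdiv : ((n : ℤ) - 1) ∣ (j : ℤ) - j' :=
    ⟨(i + 1) - (i' + 1) - (j - j'), by linear_combination h⟩
  have hz := Int.eq_zero_of_abs_lt_dvd hdiv (by rw [abs_lt]; omega)
  have hjj : (j : ℤ) = j' := by omega
  have hij : ((n : ℤ) - 1) * (i - i') = 0 := by rw [hjj] at h; linear_combination -h
  rcases mul_eq_zero.1 hij with h0 | h0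
  · omega
  · exact Prod.ext (by simp only; omega) (by simpa using hjj)

theorem label_injOn_leftCells {n : ℕ} {w : List DyckStep} (hw : w ∈ Dset n) (s : ℤ) :
    Set.InjOn (label n) (leftCells n w s) :=
  (label_injOn n).mono fun _ ⟨⟨_, h, _⟩, _⟩ => h.lt hw

theorem label_injOn_rightCells {n : ℕ} {w : List DyckStep} (hw : w ∈ Dset n) (s : ℤ) :
    Set.InjOn (label n) (rightCells n w s) :=
  (label_injOn n).mono fun _ ⟨⟨_, h, _⟩, _⟩ => h.lt hw

theorem label_image_leftCells (n : ℕ) (w : List DyckStep) (s : ℤ) :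
    label n '' leftCells n w s = label n '' leftRegion w ∩ Set.Iic s := by
  ext t
  constructor
  · rintro ⟨c, ⟨h1, h2⟩, rfl⟩; exact ⟨⟨c, h1, rfl⟩, h2⟩
  · rintro ⟨⟨c, h1, rfl⟩, h2⟩; exact ⟨c, ⟨h1, h2⟩, rfl⟩

theorem label_image_rightCells (n : ℕ) (w : List DyckStep) (s : ℤ) :
    label n '' rightCells n w s = label n '' rightRegion w ∩ Set.Ioi s := by
  ext t
  constructor
  · rintro ⟨c, ⟨h1, h2⟩, rfl⟩; exact ⟨⟨c, h1, rfl⟩, h2⟩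
  · rintro ⟨⟨c, h1, rfl⟩, h2⟩; exact ⟨c, ⟨h1, h2⟩, rfl⟩

/-! ### The value of `lastright` and the exchange of left and right. -/

theorem isGreatest_label_rightRegion {n : ℕ} (hn : 2 ≤ n) {u v : List DyckStep}
    (h : IsPeakSplit u v) (hw : u ++ v ∈ Dset n) :
    IsGreatest (label n '' rightRegion (u ++ v)) (level n u - n - (n - 1)) := by
  refine ⟨mem_label_image_rightRegion.2 ⟨level n u - n, ?_, 0, by simp⟩, fun t ht => ?_⟩
  -- The level level u - n occurs because it reflects the level 0 of Φ(w).
  · have := (mem_northLevels_Phi h hw).1 (zero_mem_northLevels hn (Phi_mem hw))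
    simpa using this
  · obtain ⟨m, hm, k, rfl⟩ := mem_label_image_rightRegion.1 ht
    have h0 := northLevels_nonneg hn (Phi_mem hw) (m := level n u - n - m)
      ((mem_northLevels_Phi h hw).2 (by simpa using hm))
    have : (0 : ℤ) ≤ (n - 1) * k := mul_nonneg (by omega) (by positivity)
    linarith

theorem lastright_append {n : ℕ} (hn : 2 ≤ n) {u v : List DyckStep}
    (h : IsPeakSplit u v) (hw : u ++ v ∈ Dset n) :
    lastright n (u ++ v) = level n u - n - (n - 1) :=
  (isGreatest_label_rightRegion hn h hw).csSup_eq

theorem isGreatest_lastright {n : ℕ} (hn : 2 ≤ n) {w : List DyckStep} (hw : w ∈ Dset n) :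
    IsGreatest (label n '' rightRegion w) (lastright n w) := by
  obtain ⟨u, v, rfl, h⟩ := exists_isPeakSplit w
  rw [lastright_append hn h hw]
  exact isGreatest_label_rightRegion hn h hw

theorem lastright_Phi {n : ℕ} (hn : 2 ≤ n) {w : List DyckStep} (hw : w ∈ Dset n) :
    lastright n (Phi w) = lastright n w := by
  have hw' := Phi_mem hw
  obtain ⟨u, v, rfl, h⟩ := exists_isPeakSplit w
  rw [lastright_append hn h hw]
  rw [Phi_append h] at hw' ⊢
  rw [lastright_append hn (h.reverse hw) hw', level_reverse]

theorem mem_label_image_rightRegion_Phi {n : ℕ} (hn : 2 ≤ n) {w : List DyckStep}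
    (hw : w ∈ Dset n) {t : ℤ} :
    t ∈ label n '' rightRegion (Phi w) ↔ lastright n w - t ∈ label n '' leftRegion w := by
  obtain ⟨u, v, rfl, h⟩ := exists_isPeakSplit w
  rw [lastright_append hn h hw, mem_label_image_rightRegion, mem_label_image_leftRegion]
  constructor
  · rintro ⟨m, hm, k, rfl⟩
    exact ⟨_, (mem_northLevels_Phi h hw).1 hm, k, by ring⟩
  · rintro ⟨m, hm, k, hk⟩
    exact ⟨level n u - n - m, (mem_northLevels_Phi h hw).2 (by simpa using hm), k,
      by linear_combination -hk⟩

/-- For integers, t ≤ s means lastright - t > lastright - s - 1; this is the source of the -1. -/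
theorem leftNum_eq_rightNum_Phi {n : ℕ} (hn : 2 ≤ n) {w : List DyckStep} (hw : w ∈ Dset n)
    (s : ℤ) : leftNum n w s = rightNum n (Phi w) (lastright n w - s - 1) := by
  rw [leftNum, rightNum, ← Set.InjOn.ncard_image (label_injOn_leftCells hw s),
    ← Set.InjOn.ncard_image (label_injOn_rightCells (Phi_mem hw) _),
    label_image_leftCells, label_image_rightCells,
    ← Set.ncard_image_of_injective _ (sub_right_injective (b := lastright n w))]
  congr 1
  ext t
  simp only [Set.mem_inter_iff, mem_label_image_rightRegion_Phi hn hw, Set.mem_Ioi]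
  constructor
  · rintro ⟨t, ⟨h1, h2⟩, rfl⟩
    have h2 : t ≤ s := h2
    exact ⟨by simpa using h1, by simp only; omega⟩
  · rintro ⟨h1, h2⟩
    exact ⟨_, ⟨h1, by simp only [Set.mem_Iic]; omega⟩, by simp⟩

theorem rightNum_eq_leftNum_Phi {n : ℕ} (hn : 2 ≤ n) {w : List DyckStep} (hw : w ∈ Dset n)
    (s : ℤ) : rightNum n w s = leftNum n (Phi w) (lastright n w - s - 1) := by
  rw [leftNum_eq_rightNum_Phi hn (Phi_mem hw), Phi_Phi hw, lastright_Phi hn hw]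
  congr 1; ring

/-! ### Finiteness, and the series `L n`. -/

theorem finite_leftCells {n : ℕ} (hn : 2 ≤ n) {w : List DyckStep} (hw : w ∈ Dset n) (s : ℤ) :
    (leftCells n w s).Finite := by
  refine Set.Finite.of_finite_image ((Set.finite_Icc 0 s).subset ?_) (label_injOn_leftCells hw s)
  rw [label_image_leftCells]
  rintro t ⟨h1, h2⟩
  obtain ⟨m, hm, k, rfl⟩ := mem_label_image_leftRegion.1 h1
  have := northLevels_nonneg hn hw hm
  have : (0 : ℤ) ≤ (n - 1) * k := mul_nonneg (by omega) (by positivity)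
  exact ⟨by linarith, h2⟩

theorem finite_rightCells {n : ℕ} (hn : 2 ≤ n) {w : List DyckStep} (hw : w ∈ Dset n) (s : ℤ) :
    (rightCells n w s).Finite := by
  refine Set.Finite.of_finite_image ((Set.finite_Ioc s (lastright n w)).subset ?_)
    (label_injOn_rightCells hw s)
  rw [label_image_rightCells]
  rintro t ⟨h1, h2⟩
  exact ⟨h2, (isGreatest_lastright hn hw).2 h1⟩

/-- The cells of row 0 left of the path have labels 0, n - 1, 2(n - 1), ..., of which d + 1 are at
most s. -/
theorem lt_leftNum {n : ℕ} (hn : 2 ≤ n) {w : List DyckStep} (hw : w ∈ Dset n) {s : ℤ} {d : ℕ}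
    (hs : ((n : ℤ) - 1) * d ≤ s) : d < leftNum n w s := by
  have hn' : (0 : ℤ) < n - 1 := by omega
  rw [leftNum, ← Set.InjOn.ncard_image (label_injOn_leftCells hw s)]
  have hinj : Function.Injective fun k : ℕ => ((n : ℤ) - 1) * k := fun a b h => by
    simpa [hn'.ne'] using h
  calc d < ((fun k : ℕ => ((n : ℤ) - 1) * k) '' (Finset.range (d + 1) : Set ℕ)).ncard := by
        rw [Set.ncard_image_of_injective _ hinj, Set.ncard_coe_finset]; simp
    _ ≤ _ := by
        refine Set.ncard_le_ncard ?_ ((finite_leftCells hn hw s).image _)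
        rw [label_image_leftCells]
        rintro _ ⟨k, hk, rfl⟩
        have hk' : (k : ℤ) ≤ d := by
          have : k < d + 1 := by simpa using hk
          omega
        refine ⟨mem_label_image_leftRegion.2
          ⟨0, zero_mem_northLevels hn hw, k, by simp⟩, le_trans ?_ hs⟩
        exact mul_le_mul_of_nonneg_left hk' hn'.le

theorem finite_setOf_leftNum_rightNum {n : ℕ} (hn : 2 ≤ n) (a b : ℕ) :
    {p : Dset n × ℤ | leftNum n p.1 p.2 = a ∧ rightNum n p.1 p.2 = b}.Finite := by
  have := (finite_Dset n).to_subtype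
  have hfib : ∀ w : Dset n,
      {p : Dset n × ℤ | p.1 = w ∧ leftNum n p.1 p.2 = a ∧ rightNum n p.1 p.2 = b}.Finite := by
    intro w
    refine (Set.Finite.image (Prod.mk w) (Set.finite_Icc
      (lastright n w - 1 - ((n : ℤ) - 1) * b) (((n : ℤ) - 1) * a))).subset ?_
    rintro ⟨_, s⟩ ⟨rfl, h1, h2⟩
    refine ⟨s, ⟨?_, ?_⟩, rfl⟩
    · by_contra! hs
      -- The exchange turns the upper bound on s for Φ(w) into a lower bound for w.
      simp only [rightNum_eq_leftNum_Phi hn (Subtype.coe_prop _)] at h2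
      exact (lt_leftNum hn (Phi_mem (Subtype.coe_prop _)) (by linarith)).ne' h2
    · by_contra! hs
      exact (lt_leftNum hn (Subtype.coe_prop _) hs.le).ne' h1
  refine (Set.finite_iUnion hfib).subset fun p hp => ?_
  exact Set.mem_iUnion.2 ⟨p.1, rfl, hp⟩

theorem coeff_term (n : ℕ) (w : List DyckStep) (s : ℤ) (d : Fin 2 →₀ ℕ) :
    MvPowerSeries.coeff d (term n w s) =
      if leftNum n w s = d 0 ∧ rightNum n w s = d 1 then 1 else 0 := by
  classical
  rw [term, MvPowerSeries.X_pow_eq, MvPowerSeries.X_pow_eq, MvPowerSeries.monomial_mul_monomial,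
    MvPowerSeries.coeff_monomial, mul_one]
  refine if_congr ?_ rfl rfl
  rw [DFunLike.ext_iff, Fin.forall_fin_two]
  simp [eq_comm]

theorem rename_swap_term {n : ℕ} (hn : 2 ≤ n) {w : List DyckStep} (hw : w ∈ Dset n) (s : ℤ) :
    MvPowerSeries.rename (Equiv.swap (0 : Fin 2) 1) (term n w s) =
      term n (Phi w) (lastright n w - s - 1) := by
  rw [term, term, map_mul, map_pow, map_pow, MvPowerSeries.rename_X, MvPowerSeries.rename_X,
    Equiv.swap_apply_left, Equiv.swap_apply_right, ← leftNum_eq_rightNum_Phi hn hw,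
    ← rightNum_eq_leftNum_Phi hn hw, mul_comm]

theorem swapMap_swapMap {n : ℕ} (hn : 2 ≤ n) {w : List DyckStep} (hw : w ∈ Dset n) (s : ℤ) :
    swapMap n (swapMap n (w, s)) = (w, s) := by
  simp only [swapMap, Phi_Phi hw, lastright_Phi hn hw, Prod.mk.injEq, true_and]
  ring

/-- `swapMap` as a permutation of `D_n × ℤ`. -/
noncomputable def swapEquiv {n : ℕ} (hn : 2 ≤ n) : Dset n × ℤ ≃ Dset n × ℤ :=
  Function.Involutive.toPerm
    (fun p => (⟨Phi p.1, Phi_mem p.1.2⟩, lastright n p.1 - p.2 - 1)) fun ⟨w, s⟩ => by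
      have h := swapMap_swapMap hn w.2 s
      simp only [swapMap, Prod.mk.injEq] at h
      exact Prod.ext (Subtype.ext h.1) h.2

theorem summable_term {n : ℕ} (hn : 2 ≤ n) :
    Summable fun p : Dset n × ℤ => term n (p.1 : List DyckStep) p.2 := by
  rw [MvPowerSeries.WithPiTopology.summable_iff_summable_coeff]
  intro d
  refine summable_of_hasFiniteSupport
    ((finite_setOf_leftNum_rightNum hn (d 0) (d 1)).subset fun p hp => ?_)
  by_contra h
  exact hp ((coeff_term _ _ _ _).trans (if_neg h))

theorem hasSum_L {n : ℕ} (hn : 2 ≤ n) :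
    HasSum (fun p : Dset n × ℤ => term n (p.1 : List DyckStep) p.2) (L n) := by
  rw [L, ← (summable_term hn).tsum_prod]
  exact (summable_term hn).hasSum

theorem rename_swap_L {n : ℕ} (hn : 2 ≤ n) :
    MvPowerSeries.rename (Equiv.swap (0 : Fin 2) 1) (L n) = L n := by
  have hsum := MvPowerSeries.WithPiTopology.hasSum_iff_hasSum_coeff.1 (hasSum_L hn)
  ext d
  obtain ⟨d, rfl⟩ : ∃ d', d = Finsupp.embDomain (Equiv.swap (0 : Fin 2) 1).toEmbedding d' :=
    ⟨Finsupp.mapDomain (Equiv.swap (0 : Fin 2) 1) d, by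
      rw [Finsupp.embDomain_eq_mapDomain, Equiv.coe_toEmbedding, ← Finsupp.mapDomain_comp,
        show ⇑(Equiv.swap (0 : Fin 2) 1) ∘ ⇑(Equiv.swap (0 : Fin 2) 1) = id from
        funext fun i => by simp, Finsupp.mapDomain_id]⟩
  have hren (f : MvPowerSeries (Fin 2) ℤ) :
      MvPowerSeries.coeff (Finsupp.embDomain (Equiv.swap (0 : Fin 2) 1).toEmbedding d)
        (MvPowerSeries.rename (Equiv.swap (0 : Fin 2) 1) f) = MvPowerSeries.coeff d f :=
    MvPowerSeries.coeff_embDomain_rename (Equiv.swap (0 : Fin 2) 1).toEmbedding f d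
  rw [hren]
  refine (hsum d).unique ?_
  -- Reindexing by the involution identifies the sums for the coefficients at d and at its swap.
  convert (swapEquiv hn).hasSum_iff.2
    (hsum (Finsupp.embDomain (Equiv.swap (0 : Fin 2) 1).toEmbedding d)) using 1
  ext p
  rw [← hren, rename_swap_term hn p.1.2]
  rfl

end DyckStrip

theorem mainTheorem9 (n : ℕ) (hn : 2 ≤ n) :
    -- `lastright`, `left` and `right` are well defined
    (∀ w ∈ DyckStrip.Dset n,
      IsGreatest (DyckStrip.label n '' DyckStrip.rightRegion w) (DyckStrip.lastright n w)) ∧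
    (∀ w ∈ DyckStrip.Dset n, ∀ s : ℤ,
      (DyckStrip.leftCells n w s).Finite ∧ (DyckStrip.rightCells n w s).Finite) ∧
    -- the map is an involution of `D_n × ℤ`
    Set.MapsTo (DyckStrip.swapMap n) (DyckStrip.Dset n ×ˢ Set.univ)
      (DyckStrip.Dset n ×ˢ Set.univ) ∧
    (∀ w ∈ DyckStrip.Dset n, ∀ s : ℤ,
      DyckStrip.swapMap n (DyckStrip.swapMap n (w, s)) = (w, s)) ∧
    -- it exchanges `left` and `right`
    (∀ w ∈ DyckStrip.Dset n, ∀ s : ℤ, ∀ w' : List DyckStep, ∀ s' : ℤ,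
      w' = DyckStrip.Phi w → s' = DyckStrip.lastright n w - s - 1 →
        DyckStrip.leftNum n w s = DyckStrip.rightNum n w' s' ∧
        DyckStrip.leftNum n w' s' = DyckStrip.rightNum n w s) ∧
    -- the series `L_n` converges as a formal power series, and `L_n(x, y) = L_n(y, x)`
    Summable (fun p : DyckStrip.Dset n × ℤ => DyckStrip.term n (p.1 : List DyckStep) p.2) ∧
    MvPowerSeries.rename (Equiv.swap (0 : Fin 2) 1) (DyckStrip.L n) = DyckStrip.L n := by
  refine ⟨fun w hw => DyckStrip.isGreatest_lastright hn hw,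
    fun w hw s => ⟨DyckStrip.finite_leftCells hn hw s, DyckStrip.finite_rightCells hn hw s⟩,
    fun p hp => ⟨DyckStrip.Phi_mem hp.1, trivial⟩,
    fun w hw s => DyckStrip.swapMap_swapMap hn hw s, ?_,
    DyckStrip.summable_term hn, DyckStrip.rename_swap_L hn⟩
  rintro w hw s _ _ rfl rfl
  exact ⟨DyckStrip.leftNum_eq_rightNum_Phi hn hw s,
    (DyckStrip.rightNum_eq_leftNum_Phi hn hw s).symm⟩
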